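/- Let $(\Omega,\mathcal F,\mathbb F=(\mathcal F_t)_{t\ge 0},\mathbb P)$ be a filtered probability space satisfying the usual conditions and supporting infinitely many independent $\mathbb F$-Brownian motions $W^1,W^2,\ldots$. Let $b\in\mathbb R$ and $n\ge 1$. Let $\mathcal A_n$ be the set of $\mathbb F$-progressively measurable processes $\Phi=(\phi^1_t,\ldots,\phi^n_t)_{t\ge 0}$ with values in $[0,1]^n$ such that $\sum_{j=1}^n\phi^j_t\le 1$ for all $t\ge 0$. For $x\in\mathbb R_+^n=[0,\infty)^n$, $\Phi\in\mathcal A_n$ and $1\le i\le n$, set $$X^{\Phi,i}_t:=x_i+\int_0^t (b+\phi^i_s)\,\mathrm ds+W^i_t,\quad t\ge 0,\qquad \tau^\Phi_i:=\inf\{t\ge 0:\ X^{\Phi,i}_t\le 0\}\quad(\inf\emptyset=\infty),$$ and define $$V^n(x):=\sup_{\Phi\in\mathcal A_n}\mathbb E\Big[\prod_{i=1}^n \mathbf 1_{\{\tau^\Phi_i=\infty\}}\Big],\qquad U^n(x):=\sup_{\Phi\in\mathcal A_n}\mathbb E\Big[\sum_{i=1}^n \mathbf 1_{\{\tau^\Phi_i=\infty\}}\Big].$$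 Then for every $x\in E_n:=(0,\infty)^n$, $$V^n(x)>0\iff b>-\frac1n,\qquad\text{and}\qquad U^n(x)>0\iff b>-1.$$ -/

import Mathlib

open MeasureTheory ProbabilityTheory
open scoped NNReal

namespace Allocation

/-- The usual conditions for `(Ω, 𝓕, (𝓕 t), P)`: the probability space is complete, `𝓕 0`
contains all `P`-null sets, and the filtration is right-continuous. -/
structure UsualConditions {Ω : Type*} {mΩ : MeasurableSpace Ω} (P : Measure Ω)
    (𝓕 : Filtration ℝ≥0 mΩ) : Prop where
  complete : P.IsComplete
  null_mem : ∀ s : Set Ω, P s = 0 → MeasurableSet[𝓕 0] s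
  right_continuous : 𝓕.IsRightContinuous

/-- A (real, standard) Brownian motion relative to the filtration `𝓕`: a Brownian motion that is
`𝓕`-adapted and whose increments after time `s` are independent of `𝓕 s`. -/
structure IsFBrownianMotion {Ω : Type*} {mΩ : MeasurableSpace Ω} (P : Measure Ω)
    (𝓕 : Filtration ℝ≥0 mΩ) (B : ℝ≥0 → Ω → ℝ) : Prop where
  brownian : IsBrownianReal B P
  adapted : Adapted 𝓕 B
  indep_increment : ∀ s t : ℝ≥0, s ≤ t →
    Indep (MeasurableSpace.comap (fun ω => B t ω - B s ω) inferInstance) (𝓕 s) P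

/-- The admissible controls: `𝓕`-progressively measurable `[0,1]ⁿ`-valued processes
whose coordinates sum to at most one. -/
def admissible {Ω : Type*} {mΩ : MeasurableSpace Ω} (𝓕 : Filtration ℝ≥0 mΩ) (n : ℕ) :
    Set (ℝ≥0 → Ω → Fin n → ℝ) :=
  {Φ | IsProgressive 𝓕 Φ ∧ (∀ t ω i, Φ t ω i ∈ Set.Icc (0 : ℝ) 1) ∧
    ∀ t ω, ∑ j, Φ t ω j ≤ 1}

/-- The `i`-th coordinate of the controlled process started at `x`:
`X t = x i + ∫₀ᵗ (b + φⁱ s) ds + Wⁱ t`. The Brownian motions are indexed by `0, 1, 2, …`. -/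
noncomputable def state {Ω : Type*} (W : ℕ → ℝ≥0 → Ω → ℝ) (b : ℝ) {n : ℕ} (x : Fin n → ℝ)
    (Φ : ℝ≥0 → Ω → Fin n → ℝ) (i : Fin n) (t : ℝ≥0) (ω : Ω) : ℝ :=
  x i + (∫ s in (0 : ℝ)..(t : ℝ), (b + Φ s.toNNReal ω i)) + W i t ω

/-- The ruin time of the `i`-th coordinate: the infimum of the times `t ≥ 0` at which the
controlled coordinate is `≤ 0`, equal to `⊤` if there is no such time. -/
noncomputable def ruinTime {Ω : Type*} (W : ℕ → ℝ≥0 → Ω → ℝ) (b : ℝ) {n : ℕ} (x : Fin n → ℝ)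
    (Φ : ℝ≥0 → Ω → Fin n → ℝ) (i : Fin n) : Ω → WithTop ℝ≥0 :=
  hittingAfter (state W b x Φ i) (Set.Iic 0) 0

/-- The indicator of the event that the `i`-th coordinate is never ruined. -/
noncomputable def survives {Ω : Type*} (W : ℕ → ℝ≥0 → Ω → ℝ) (b : ℝ) {n : ℕ} (x : Fin n → ℝ)
    (Φ : ℝ≥0 → Ω → Fin n → ℝ) (i : Fin n) : Ω → ℝ :=
  Set.indicator {ω | ruinTime W b x Φ i ω = ⊤} (fun _ => 1)

/-- The all-survive value function. -/
noncomputable def V {Ω : Type*} {mΩ : MeasurableSpace Ω} (P : Measure Ω)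
    (𝓕 : Filtration ℝ≥0 mΩ) (W : ℕ → ℝ≥0 → Ω → ℝ) (b : ℝ) (n : ℕ) (x : Fin n → ℝ) : ℝ :=
  ⨆ Φ : admissible 𝓕 n, ∫ ω, ∏ i, survives W b x Φ i ω ∂P

/-- The count-survivors value function. -/
noncomputable def U {Ω : Type*} {mΩ : MeasurableSpace Ω} (P : Measure Ω)
    (𝓕 : Filtration ℝ≥0 mΩ) (W : ℕ → ℝ≥0 → Ω → ℝ) (b : ℝ) (n : ℕ) (x : Fin n → ℝ) : ℝ :=
  ⨆ Φ : admissible 𝓕 n, ∫ ω, ∑ i, survives W b x Φ i ω ∂P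

/-- The open orthant `(0,∞)ⁿ`. -/
def openOrthant (n : ℕ) : Set (Fin n → ℝ) := {x | ∀ i, 0 < x i}

/-! The suprema defining `V` and `U` are over nonempty families that are bounded above. -/

theorem admissible_nonempty {Ω : Type*} {mΩ : MeasurableSpace Ω} (𝓕 : Filtration ℝ≥0 mΩ)
    (n : ℕ) : (admissible 𝓕 n).Nonempty :=
  ⟨fun _ _ _ => 0, isProgressive_const 𝓕 (fun _ : Fin n => (0 : ℝ)), by simp, by simp⟩

theorem survives_nonneg {Ω : Type*} (W : ℕ → ℝ≥0 → Ω → ℝ) (b : ℝ) {n : ℕ}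
    (x : Fin n → ℝ) (Φ : ℝ≥0 → Ω → Fin n → ℝ) (i : Fin n) (ω : Ω) :
    0 ≤ survives W b x Φ i ω :=
  Set.indicator_nonneg (fun _ _ => zero_le_one) ω

theorem survives_le_one {Ω : Type*} (W : ℕ → ℝ≥0 → Ω → ℝ) (b : ℝ) {n : ℕ}
    (x : Fin n → ℝ) (Φ : ℝ≥0 → Ω → Fin n → ℝ) (i : Fin n) (ω : Ω) :
    survives W b x Φ i ω ≤ 1 :=
  Set.indicator_le_self' (fun _ _ => zero_le_one) ω

theorem bddAbove_V {Ω : Type*} {mΩ : MeasurableSpace Ω} (P : Measure Ω)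
    [IsProbabilityMeasure P] (𝓕 : Filtration ℝ≥0 mΩ) (W : ℕ → ℝ≥0 → Ω → ℝ) (b : ℝ) (n : ℕ)
    (x : Fin n → ℝ) :
    BddAbove (Set.range fun Φ : admissible 𝓕 n => ∫ ω, ∏ i, survives W b x Φ i ω ∂P) := by
  refine ⟨1, ?_⟩
  rintro _ ⟨Φ, rfl⟩
  have h := norm_integral_le_of_norm_le_const (μ := P)
    (f := fun ω => ∏ i, survives W b x Φ i ω) (C := 1) (.of_forall fun ω => by
      rw [Real.norm_of_nonneg (Finset.prod_nonneg fun i _ => survives_nonneg W b x Φ i ω)]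
      exact Finset.prod_le_one (fun i _ => survives_nonneg W b x Φ i ω)
        (fun i _ => survives_le_one W b x Φ i ω))
  simpa using (le_abs_self _).trans h

theorem bddAbove_U {Ω : Type*} {mΩ : MeasurableSpace Ω} (P : Measure Ω)
    [IsProbabilityMeasure P] (𝓕 : Filtration ℝ≥0 mΩ) (W : ℕ → ℝ≥0 → Ω → ℝ) (b : ℝ) (n : ℕ)
    (x : Fin n → ℝ) :
    BddAbove (Set.range fun Φ : admissible 𝓕 n => ∫ ω, ∑ i, survives W b x Φ i ω ∂P) := by
  refine ⟨n, ?_⟩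
  rintro _ ⟨Φ, rfl⟩
  have h := norm_integral_le_of_norm_le_const (μ := P)
    (f := fun ω => ∑ i, survives W b x Φ i ω) (C := n) (.of_forall fun ω => by
      rw [Real.norm_of_nonneg (Finset.sum_nonneg fun i _ => survives_nonneg W b x Φ i ω)]
      simpa using Finset.sum_le_sum fun i (_ : i ∈ Finset.univ) =>
        survives_le_one W b x Φ i ω)
  simpa using (le_abs_self _).trans h

end Allocation

/-! Necessity. If all coordinates survive, their sum stays positive; its drift is at most `n * b +
1`, and its noise is `√n` times a Brownian motion. When `b ≤ -1/n` the drift is nonpositive, while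
Brownian motion is a.s. unbounded below (`ae_forall_exists_le_neg`), so the sum reaches `≤ 0` under
every control. For a single coordinate the drift is at most `b + 1`, and the same argument applies
when `b ≤ -1`.

Sufficiency. Constant controls are enough: `1/n` to each coordinate for `V`, everything to one
coordinate for `U`. A Brownian motion with drift `μ > 0` started at `y > 0` stays positive with
positive probability, by Doob's inequality for `exp (-2μ (W t + μ t))` (`measure_pathsAbove_pos`);
for `V`, independence turns this into a product of positive factors. -/

namespace Allocation

open Filter Topology

/-! ### Brownian motion is unbounded below; sums of independent Brownian motions. -/

section Oscillation

variable {Ω : Type*} {mΩ : MeasurableSpace Ω} {P : Measure Ω}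

/-- Unboundedness below along the integers does not change when `B N` is subtracted, so for every
`N` it depends only on increments after time `N`. This makes it a tail event for Kolmogorov's
zero-one law. -/
lemma measurableSet_limsup_increments (B : ℝ≥0 → Ω → ℝ) :
    MeasurableSet[limsup (fun k : ℕ => MeasurableSpace.comap
      (fun ω => B ((k + 1 : ℕ) : ℝ≥0) ω - B (k : ℝ≥0) ω) inferInstance) atTop]
      {ω | ∀ M j : ℕ, ∃ k ≥ j, B (k : ℝ≥0) ω ≤ -(M : ℝ)} := by
  rw [limsup_eq_iInf_iSup_of_nat, MeasurableSpace.measurableSet_iInf]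
  intro N
  set m : MeasurableSpace Ω := ⨆ i ≥ N, MeasurableSpace.comap
      (fun ω => B ((i + 1 : ℕ) : ℝ≥0) ω - B (i : ℝ≥0) ω) inferInstance with hm
  have hinc : ∀ k ≥ N, Measurable[m] fun ω => B (k : ℝ≥0) ω - B (N : ℝ≥0) ω := by
    intro k hk
    induction k, hk using Nat.le_induction with
    | base => simp only [sub_self]; exact measurable_const
    | succ k hk ih =>
      have h1 : Measurable[m] fun ω => B ((k + 1 : ℕ) : ℝ≥0) ω - B (k : ℝ≥0) ω :=
        (comap_measurable _).mono (le_iSup₂_of_le k hk le_rfl) le_rfl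
      convert h1.add ih using 2
      simp
  have hset : {ω | ∀ M j : ℕ, ∃ k ≥ j, B (k : ℝ≥0) ω ≤ -(M : ℝ)} =
      ⋂ M : ℕ, ⋂ j : ℕ, ⋃ k : ℕ, ⋃ _ : j ≤ k, ⋃ _ : N ≤ k,
        {ω | B (k : ℝ≥0) ω - B (N : ℝ≥0) ω ≤ -(M : ℝ)} := by
    ext ω
    simp only [Set.mem_ofPred_eq, Set.mem_iInter, Set.mem_iUnion, exists_prop]
    constructor
    · intro h M j
      obtain ⟨M', hM'⟩ := exists_nat_ge (M - B (N : ℝ≥0) ω)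
      obtain ⟨k, hk, hB⟩ := h M' (max j N)
      exact ⟨k, le_of_max_le_left hk, le_of_max_le_right hk, by linarith⟩
    · intro h M j
      obtain ⟨M', hM'⟩ := exists_nat_ge (M + B (N : ℝ≥0) ω)
      obtain ⟨k, hk, -, hB⟩ := h M' j
      exact ⟨k, hk, by linarith⟩
  rw [hset]
  refine MeasurableSet.iInter fun M => MeasurableSet.iInter fun j => MeasurableSet.iUnion fun k =>
    MeasurableSet.iUnion fun _ => MeasurableSet.iUnion fun hk => ?_
  exact (hinc k hk) measurableSet_Iic

/-- The probability that a nondegenerate centred Brownian marginal lies below minus its standard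
deviation does not depend on time. -/
lemma measure_le_neg_sqrt {B : ℝ≥0 → Ω → ℝ} (hB : IsPreBrownianReal B P) (t : ℝ≥0) (ht : t ≠ 0) :
    P {ω | B t ω ≤ -√(t : ℝ)} = gaussianReal 0 1 (Set.Iic (-1)) := by
  have h1 := (hB.smul ht).hasLaw_eval 1
  have h2 := h1.measure_eq (p := fun x => x ≤ -1) measurableSet_Iic
  rw [show Set.Iic (-1 : ℝ) = {x | x ≤ -1} from rfl, ← h2]
  congr 1
  ext ω
  have hs : 0 < √(t : ℝ) := Real.sqrt_pos.2 (by positivity)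
  simp only [Set.mem_ofPred_eq, mul_one]
  rw [inv_mul_le_iff₀ hs, mul_neg_one]

lemma gaussianReal_Iic_pos (a : ℝ) : 0 < gaussianReal 0 1 (Set.Iic a) := by
  rw [pos_iff_ne_zero]
  intro h
  have h2 : volume (Set.Iic a) = 0 := gaussianReal_absolutelyContinuous' 0 one_ne_zero h
  simp at h2

/-- A Brownian motion is almost surely unbounded below. -/
theorem ae_forall_exists_le_neg [IsProbabilityMeasure P] {B : ℝ≥0 → Ω → ℝ}
    (hB : IsPreBrownianReal B P) (hmeas : ∀ t, Measurable (B t)) :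
    ∀ᵐ ω ∂P, ∀ c : ℝ, ∃ t, B t ω ≤ -c := by
  set T : Set Ω := {ω | ∀ M j : ℕ, ∃ k ≥ j, B (k : ℝ≥0) ω ≤ -(M : ℝ)} with hT
  have hmono : Monotone fun k : ℕ => (k : ℝ≥0) := Nat.mono_cast
  have hind : iIndepFun (fun (k : ℕ) ω => B ((k + 1 : ℕ) : ℝ≥0) ω - B (k : ℝ≥0) ω) P :=
    hB.hasIndepIncrements.nat hmono
  have h01 : P T = 0 ∨ P T = 1 :=
    measure_zero_or_one_of_measurableSet_limsup_atTop
      (fun k => ((hmeas _).sub (hmeas _)).comap_le) hind.iIndep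
      (measurableSet_limsup_increments B)
  set A : ℕ → Set Ω := fun k => {ω | B (k : ℝ≥0) ω ≤ -√(k : ℝ)} with hA
  have hAm : ∀ k, MeasurableSet (A k) := fun k => measurableSet_le (hmeas _) measurable_const
  have hsub : (⋂ j : ℕ, ⋃ k ≥ j, A k) ⊆ T := by
    intro ω hω M j
    simp only [Set.mem_iInter, Set.mem_iUnion, exists_prop] at hω
    -- `k ≥ M ^ 2` gives `√k ≥ M`.
    obtain ⟨k, hk, hkA⟩ := hω (max j (M ^ 2))
    refine ⟨k, le_of_max_le_left hk, le_trans hkA ?_⟩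
    rw [neg_le_neg_iff]
    apply Real.le_sqrt_of_sq_le
    exact_mod_cast le_of_max_le_right hk
  -- Each tail union contains `A (j + 1)`, whose probability is a constant independent of `j`; the
  -- index `j + 1` avoids time zero, where scaling fails.
  have hpos : gaussianReal 0 1 (Set.Iic (-1)) ≤ P (⋂ j : ℕ, ⋃ k ≥ j, A k) := by
    rw [Antitone.measure_iInter]
    · refine le_iInf fun j => ?_
      have h1 := measure_le_neg_sqrt hB ((j + 1 : ℕ) : ℝ≥0) (by positivity)
      rw [← h1]
      refine measure_mono fun ω hω => ?_
      simp only [Set.mem_iUnion]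
      refine ⟨j + 1, by simp, ?_⟩
      simpa [A] using hω
    · intro i j hij ω
      simp only [Set.mem_iUnion, exists_prop]
      rintro ⟨k, hk, h⟩
      exact ⟨k, le_trans hij hk, h⟩
    · exact fun j => (MeasurableSet.iUnion fun k => MeasurableSet.iUnion fun _ =>
        hAm k).nullMeasurableSet
    · exact ⟨0, measure_ne_top _ _⟩
  have hne : P T ≠ 0 :=
    ((gaussianReal_Iic_pos (-1)).trans_le (hpos.trans (measure_mono hsub))).ne'
  have hT1 : P T = 1 := h01.resolve_left hne
  have hTm : MeasurableSet T := by
    have : T = ⋂ M : ℕ, ⋂ j : ℕ, ⋃ k : ℕ, ⋃ _ : j ≤ k, {ω | B (k : ℝ≥0) ω ≤ -(M : ℝ)} := by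
      ext ω; simp [T]
    rw [this]
    exact MeasurableSet.iInter fun M => MeasurableSet.iInter fun j => MeasurableSet.iUnion fun k =>
      MeasurableSet.iUnion fun _ => measurableSet_le (hmeas _) measurable_const
  have hae : ∀ᵐ ω ∂P, ω ∈ T := (mem_ae_iff_prob_eq_one hTm).2 hT1
  filter_upwards [hae] with ω hω c
  obtain ⟨M, hM⟩ := exists_nat_ge c
  obtain ⟨k, -, hk⟩ := hω M 0
  exact ⟨k, by linarith⟩

/-- The normalised sum of independent Brownian motions has Brownian finite-dimensional laws. -/
theorem isPreBrownianReal_sum [IsProbabilityMeasure P] {n : ℕ} (hn : n ≠ 0)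
    {W : Fin n → ℝ≥0 → Ω → ℝ} (hW : ∀ i, IsPreBrownianReal (W i) P)
    (hind : iIndepFun (fun i ω t => W i t ω) P) :
    IsPreBrownianReal (fun t ω => (√(n : ℝ))⁻¹ * ∑ i, W i t ω) P := by
  have hL2 : ∀ i t, MemLp (W i t) 2 P := fun i t =>
    ((IsPreBrownianReal.isGaussianProcess (hW i)).hasGaussianLaw_eval t).memLp_two
  refine IsGaussianProcess.isPreBrownianReal_of_covariance ?_ (fun t => ?_) (fun s t hst => ?_)
  · have hsum : IsGaussianProcess (fun t ω => ∑ i, W i t ω) P := by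
      refine ⟨fun I => ?_⟩
      have hI : iIndepFun (fun (i : Fin n) ω => I.restrict (fun t => W i t ω)) P :=
        hind.comp (fun _ w => I.restrict w) (fun _ => Finset.measurable_restrict I)
      have := iIndepFun.hasGaussianLaw_fun_sum
        (fun i => (IsPreBrownianReal.isGaussianProcess (hW i)).hasGaussianLaw I) hI
      have heq : (fun ω => I.restrict (fun t => ∑ i, W i t ω)) =
          fun ω => ∑ i, I.restrict (fun t => W i t ω) := by
        ext ω t
        simp
      exact heq ▸ this
    exact hsum.smul fun _ => (√(n : ℝ))⁻¹
  · rw [integral_const_mul, integral_finsetSum _ fun i _ => (hW i).integrable_eval t]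
    simp [(hW _).integral_eval]
  -- Cross terms vanish by independence, leaving `n * s`, which the normalisation by `√n` reduces to
  -- `s`.
  · have hcov : cov[fun ω => ∑ i, W i s ω, fun ω => ∑ i, W i t ω; P] = n * s := by
      rw [covariance_fun_sum_fun_sum (fun i => hL2 i s) (fun i => hL2 i t)]
      have hij : ∀ i j, cov[W i s, W j t; P] = if i = j then (s : ℝ) else 0 := by
        intro i j
        split_ifs with h
        · subst h
          rw [(hW i).covariance_eval, min_eq_left hst]
        · have : IndepFun (W i s) (W j t) P :=
            (hind.indepFun h).comp (measurable_pi_apply s) (measurable_pi_apply t)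
          exact this.covariance_eq_zero (hL2 i s) (hL2 j t)
      simp [hij]
    rw [covariance_const_mul_left, covariance_const_mul_right, hcov]
    have : (0 : ℝ) < n := by positivity
    rw [← mul_assoc, ← mul_assoc, ← mul_inv, Real.mul_self_sqrt this.le, inv_mul_cancel₀ this.ne',
      one_mul]

end Oscillation

/-! ### Survival of Brownian motion with positive drift. -/

section Drift

variable {Ω : Type*} {mΩ : MeasurableSpace Ω} {P : Measure Ω}

lemma integrable_exp_mul_of_hasLaw {X : Ω → ℝ} {v : ℝ≥0} (hX : HasLaw X (gaussianReal 0 v) P)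
    (θ : ℝ) : Integrable (fun ω => Real.exp (θ * X ω)) P := by
  have h := integrable_exp_mul_gaussianReal (μ := 0) (v := v) θ
  rw [← hX.map_eq] at h
  exact h.comp_aemeasurable hX.aemeasurable

lemma integral_exp_mul_of_hasLaw {X : Ω → ℝ} {v : ℝ≥0} (hX : HasLaw X (gaussianReal 0 v) P)
    (θ : ℝ) : ∫ ω, Real.exp (θ * X ω) ∂P = Real.exp (v * θ ^ 2 / 2) := by
  have h := mgf_gaussianReal hX.map_eq θ
  simpa [mgf] using h

/-- The filtration `𝓕` sampled along the grid `0, h, 2h, …`. -/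
def gridFiltration (𝓕 : Filtration ℝ≥0 mΩ) (h : ℝ≥0) : Filtration ℕ mΩ where
  seq k := 𝓕 (k * h)
  mono' i j hij := 𝓕.mono (by gcongr)
  le' k := 𝓕.le _

/-- The exponential martingale `exp (-2μ (W t + μ t))` sampled along the grid `0, h, 2h, …`. -/
noncomputable def gridExp (W : ℝ≥0 → Ω → ℝ) (μ : ℝ) (h : ℝ≥0) (k : ℕ) (ω : Ω) : ℝ :=
  Real.exp (-2 * μ * (W (k * h) ω + μ * (k * h)))

lemma gridExp_eq (W : ℝ≥0 → Ω → ℝ) (μ : ℝ) (h : ℝ≥0) (k : ℕ) (ω : Ω) :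
    gridExp W μ h k ω =
      Real.exp (-2 * μ * W (k * h) ω) * Real.exp (-2 * μ ^ 2 * (k * h)) := by
  rw [gridExp, ← Real.exp_add]
  congr 1
  ring

lemma integrable_gridExp {W : ℝ≥0 → Ω → ℝ} (hW : IsPreBrownianReal W P) (μ : ℝ) (h : ℝ≥0)
    (k : ℕ) : Integrable (gridExp W μ h k) P := by
  simp only [funext (gridExp_eq W μ h k)]
  exact (integrable_exp_mul_of_hasLaw (hW.hasLaw_eval _) _).mul_const _

lemma integral_gridExp {W : ℝ≥0 → Ω → ℝ} (hW : IsPreBrownianReal W P) (μ : ℝ) (h : ℝ≥0)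
    (k : ℕ) : ∫ ω, gridExp W μ h k ω ∂P = 1 := by
  simp only [gridExp_eq W μ h k]
  rw [integral_mul_const, integral_exp_mul_of_hasLaw (hW.hasLaw_eval _), ← Real.exp_add,
    Real.exp_eq_one_iff]
  push_cast
  ring

/-- The ratio of consecutive terms depends only on an increment independent of the past, and has
mean `exp (2μ²h) * exp (-2μ²h) = 1`. -/
lemma martingale_gridExp [IsProbabilityMeasure P] {𝓕 : Filtration ℝ≥0 mΩ} {W : ℝ≥0 → Ω → ℝ}
    (hW : IsFBrownianMotion P 𝓕 W) (μ : ℝ) (h : ℝ≥0) :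
    Martingale (gridExp W μ h) (gridFiltration 𝓕 h) P := by
  have hpre := hW.brownian.toIsPreBrownianReal
  have hsm : ∀ k : ℕ, StronglyMeasurable[𝓕 (k * h)] (gridExp W μ h k) := fun k => by
    have : Measurable[𝓕 (k * h)] (W (k * h)) := hW.adapted _
    have h2 : Measurable[𝓕 (k * h)] (gridExp W μ h k) :=
      Real.measurable_exp.comp ((this.add_const _).const_mul _)
    exact h2.stronglyMeasurable
  refine martingale_nat hsm (integrable_gridExp hpre μ h) fun k => ?_
  set D : Ω → ℝ := fun ω => W ((k + 1 : ℕ) * h) ω - W (k * h) ω with hD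
  set g : Ω → ℝ := fun ω => Real.exp (-2 * μ * D ω) with hg
  have hkk : (k : ℝ≥0) * h ≤ (k + 1 : ℕ) * h := by gcongr; simp
  have hDlaw : HasLaw D (gaussianReal 0 h) P := by
    have := hpre.hasLaw_sub ((k + 1 : ℕ) * h) (k * h)
    have hv : nndist (((k + 1 : ℕ) : ℝ≥0) * h).1 ((k : ℝ≥0) * h).1 = h := by
      apply NNReal.eq
      rw [coe_nndist, Real.dist_eq]
      change |(((k + 1 : ℕ) : ℝ≥0) * h : ℝ≥0) - ((k * h : ℝ≥0) : ℝ)| = (h : ℝ)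
      push_cast
      rw [show ((k : ℝ) + 1) * h - k * h = h by ring, abs_of_nonneg h.coe_nonneg]
    rwa [hv] at this
  have hstep : gridExp W μ h (k + 1) =
      gridExp W μ h k * fun ω => g ω * Real.exp (-2 * μ ^ 2 * h) := by
    ext ω
    simp only [gridExp, Pi.mul_apply, g, D, ← Real.exp_add]
    congr 1
    push_cast
    ring
  have hgint : Integrable (fun ω => g ω * Real.exp (-2 * μ ^ 2 * h)) P :=
    (integrable_exp_mul_of_hasLaw hDlaw _).mul_const _
  have hcomapm : MeasurableSpace.comap D inferInstance ≤ mΩ := by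
    have h1 : Measurable (W ((k + 1 : ℕ) * h)) := (hW.adapted _).mono (𝓕.le _) le_rfl
    have h2 : Measurable (W (k * h)) := (hW.adapted _).mono (𝓕.le _) le_rfl
    exact (h1.sub h2).comap_le
  have hcond : P[fun ω => g ω * Real.exp (-2 * μ ^ 2 * h) | 𝓕 (k * h)] =ᵐ[P] fun _ => 1 := by
    have h1 : StronglyMeasurable[MeasurableSpace.comap D inferInstance]
        (fun ω => g ω * Real.exp (-2 * μ ^ 2 * h)) := by
      have hDm : Measurable[MeasurableSpace.comap D inferInstance] D := comap_measurable D
      exact ((Real.measurable_exp.comp (hDm.const_mul _)).mul_const _).stronglyMeasurable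
    have h2 := condExp_indep_eq hcomapm (𝓕.le (k * h)) h1 (hW.indep_increment _ _ hkk)
    refine h2.trans (Eventually.of_forall fun _ => ?_)
    simp only [hg]
    rw [integral_mul_const, integral_exp_mul_of_hasLaw hDlaw, ← Real.exp_add, Real.exp_eq_one_iff]
    ring
  have hmul := condExp_mul_of_stronglyMeasurable_left (μ := P) (hsm k)
    (hstep ▸ integrable_gridExp hpre μ h (k + 1)) hgint
  rw [hstep]
  refine EventuallyEq.symm (hmul.trans ?_)
  filter_upwards [hcond] with ω hω
  rw [Pi.mul_apply, hω, mul_one]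

/-- Reaching `-y` forces the mean-one exponential martingale up to `exp (2μy)`, so Doob's maximal
inequality applies. The bound is uniform in the mesh and the horizon. -/
lemma measure_exists_grid_le [IsProbabilityMeasure P] {𝓕 : Filtration ℝ≥0 mΩ} {W : ℝ≥0 → Ω → ℝ}
    (hW : IsFBrownianMotion P 𝓕 W) {μ : ℝ} (hμ : 0 ≤ μ) (y : ℝ) (h : ℝ≥0) (N : ℕ) :
    P {ω | ∃ k ≤ N, W (k * h) ω + μ * (k * h) ≤ -y} ≤
      ENNReal.ofReal (Real.exp (-2 * μ * y)) := by
  have hpre := hW.brownian.toIsPreBrownianReal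
  set ε : ℝ≥0 := ⟨Real.exp (2 * μ * y), (Real.exp_pos _).le⟩ with hε
  have hmax := maximal_ineq (martingale_gridExp hW μ h).submartingale
    (fun k ω => (Real.exp_pos _).le) (ε := ε) N
  have hle : (ε : ENNReal) * P {ω | ∃ k ≤ N, W (k * h) ω + μ * (k * h) ≤ -y} ≤ 1 := by
    refine le_trans (mul_le_mul_right (measure_mono ?_) _) (hmax.trans ?_)
    · rintro ω ⟨k, hk, hle⟩
      simp only [Set.mem_ofPred_eq, Finset.le_sup'_iff]
      refine ⟨k, by simpa using Nat.lt_succ_of_le hk, ?_⟩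
      change Real.exp (2 * μ * y) ≤ Real.exp _
      rw [Real.exp_le_exp]
      nlinarith
    · rw [← ENNReal.ofReal_one]
      refine ENNReal.ofReal_le_ofReal ?_
      rw [← integral_gridExp hpre μ h N]
      exact setIntegral_le_integral (integrable_gridExp hpre μ h N)
        (Eventually.of_forall fun ω => (Real.exp_pos _).le)
  have hε' : (ε : ENNReal) = ENNReal.ofReal (Real.exp (2 * μ * y)) :=
    (ENNReal.ofReal_eq_coe_nnreal _).symm
  rw [show -2 * μ * y = -(2 * μ * y) by ring, Real.exp_neg,
    ENNReal.ofReal_inv_of_pos (Real.exp_pos _), ← hε', ENNReal.le_inv_iff_mul_le, mul_comm]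
  exact hle

/-- The paths which, after adding the drift `μ`, stay above `-y` at all dyadic times. -/
def pathsAbove (μ y : ℝ) : Set (ℝ≥0 → ℝ) :=
  {w | ∀ m k : ℕ, -y < w (k * (2 ^ m)⁻¹) + μ * (k * (2 ^ m)⁻¹)}

/-- Only countably many times are constrained, so the set lies in the product σ-algebra, where
independence of whole paths can be used. -/
lemma measurableSet_pathsAbove (μ y : ℝ) : MeasurableSet (pathsAbove μ y) := by
  have : pathsAbove μ y = ⋂ m : ℕ, ⋂ k : ℕ,
      {w | -y < w (k * (2 ^ m)⁻¹) + μ * (k * (2 ^ m)⁻¹)} := by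
    ext w; simp [pathsAbove]
  rw [this]
  exact MeasurableSet.iInter fun m => MeasurableSet.iInter fun k =>
    measurableSet_lt measurable_const ((measurable_pi_apply _).add_const _)

/-- Grids of mesh `2⁻ᵐ` up to time `2ᵐ` are nested and exhaust the dyadic times, so the uniform
bound passes to the increasing union. -/
lemma measure_not_pathsAbove_le [IsProbabilityMeasure P] {𝓕 : Filtration ℝ≥0 mΩ}
    {W : ℝ≥0 → Ω → ℝ} (hW : IsFBrownianMotion P 𝓕 W) {μ : ℝ} (hμ : 0 ≤ μ) (y : ℝ) :
    P {ω | (fun t => W t ω) ∉ pathsAbove μ y} ≤ ENNReal.ofReal (Real.exp (-2 * μ * y)) := by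
  set A : ℕ → Set Ω := fun m =>
    {ω | ∃ k ≤ 4 ^ m, W ((k : ℕ) * (2 ^ m)⁻¹) ω + μ * (k * (2 ^ m)⁻¹) ≤ -y} with hA
  have hrefine : ∀ (m l k : ℕ), ((2 ^ l * k : ℕ) : ℝ≥0) * (2 ^ (m + l))⁻¹ = k * (2 ^ m)⁻¹ := by
    intro m l k
    push_cast
    rw [pow_add]
    field_simp
  have hrefine' : ∀ (m l k : ℕ), ((2 ^ l * k : ℕ) : ℝ) * (2 ^ (m + l))⁻¹ = k * (2 ^ m)⁻¹ := by
    intro m l k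
    push_cast
    rw [pow_add]
    field_simp
  have hmono : Monotone A := by
    refine monotone_nat_of_le_succ fun m ω => ?_
    rintro ⟨k, hk, h⟩
    refine ⟨2 ^ 1 * k, ?_, ?_⟩
    · rw [pow_succ]; omega
    · rwa [hrefine, hrefine']
  have hsub : {ω | (fun t => W t ω) ∉ pathsAbove μ y} ⊆ ⋃ m, A m := by
    intro ω hω
    simp only [pathsAbove, Set.mem_ofPred_eq, not_forall, not_lt] at hω
    obtain ⟨m, k, h⟩ := hω
    -- Refining `k` more times keeps the time fixed and brings its index within `4 ^ (m + k)`, since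
    -- `k ≤ 2 ^ k`.
    refine Set.mem_iUnion.2 ⟨m + k, 2 ^ k * k, ?_, ?_⟩
    · calc 2 ^ k * k ≤ 2 ^ k * 2 ^ k := by gcongr; exact Nat.lt_two_pow_self.le
        _ = 4 ^ k := by rw [← mul_pow]; norm_num
        _ ≤ 4 ^ (m + k) := by gcongr <;> omega
    · rwa [hrefine, hrefine']
  refine (measure_mono hsub).trans ?_
  rw [hmono.measure_iUnion]
  refine iSup_le fun m => ?_
  have := measure_exists_grid_le hW hμ y (2 ^ m)⁻¹ (4 ^ m)
  push_cast at this
  exact this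

lemma measure_pathsAbove_pos [IsProbabilityMeasure P] {𝓕 : Filtration ℝ≥0 mΩ}
    {W : ℝ≥0 → Ω → ℝ} (hW : IsFBrownianMotion P 𝓕 W) {μ y : ℝ} (hμ : 0 < μ) (hy : 0 < y) :
    0 < P {ω | (fun t => W t ω) ∈ pathsAbove μ y} := by
  rw [pos_iff_ne_zero]
  intro h0
  have h1 : P {ω | (fun t => W t ω) ∉ pathsAbove μ y} = 1 := by
    have : ∀ᵐ ω ∂P, (fun t => W t ω) ∉ pathsAbove μ y := by
      rw [ae_iff]; simpa using h0
    rw [measure_congr (eventuallyEq_univ.2 this), measure_univ]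
  have h2 := measure_not_pathsAbove_le hW hμ.le y
  rw [h1, ENNReal.one_le_ofReal, Real.one_le_exp_iff] at h2
  nlinarith [mul_pos hμ hy]

/-- Every `t` is the limit of `⌊t 2ᵐ⌋ / 2ᵐ`. The limit loses strictness, which is why `x i / 2` is
used below in place of `x i`. -/
lemma le_of_mem_pathsAbove {μ y : ℝ} {w : ℝ≥0 → ℝ} (hc : Continuous w)
    (hw : w ∈ pathsAbove μ y) (t : ℝ≥0) : -y ≤ w t + μ * t := by
  have hcont : Continuous fun t : ℝ≥0 => w t + μ * t := by fun_prop
  have hlim : Tendsto (fun m : ℕ => (⌊(t : ℝ) * 2 ^ m⌋₊ : ℝ≥0) * (2 ^ m)⁻¹) atTop (𝓝 t) := by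
    rw [← NNReal.tendsto_coe]
    have h2 : Tendsto (fun m : ℕ => (2 : ℝ) ^ m) atTop atTop :=
      tendsto_pow_atTop_atTop_of_one_lt one_lt_two
    simpa [Function.comp_def, div_eq_mul_inv] using
      (tendsto_nat_floor_mul_div_atTop t.2).comp h2
  refine ge_of_tendsto ((hcont.tendsto t).comp hlim) (Eventually.of_forall fun m => ?_)
  have := (hw m ⌊(t : ℝ) * 2 ^ m⌋₊).le
  simpa using this

end Drift

/-! ### Survival under admissible controls and the two value functions. -/

section Controls

variable {Ω : Type*} {mΩ : MeasurableSpace Ω} {P : Measure Ω}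

lemma survives_eq_one_iff {W : ℕ → ℝ≥0 → Ω → ℝ} {b : ℝ} {n : ℕ} {x : Fin n → ℝ}
    {Φ : ℝ≥0 → Ω → Fin n → ℝ} {i : Fin n} {ω : Ω} :
    survives W b x Φ i ω = 1 ↔ ∀ t, 0 < state W b x Φ i t ω := by
  simp [survives, ruinTime, hittingAfter_eq_top_iff]

lemma survives_ne_zero_iff {W : ℕ → ℝ≥0 → Ω → ℝ} {b : ℝ} {n : ℕ} {x : Fin n → ℝ}
    {Φ : ℝ≥0 → Ω → Fin n → ℝ} {i : Fin n} {ω : Ω} :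
    survives W b x Φ i ω ≠ 0 ↔ ∀ t, 0 < state W b x Φ i t ω := by
  simp [survives, ruinTime, hittingAfter_eq_top_iff]

lemma integral_nonpos_of_forall {f : ℝ → ℝ} {a b : ℝ} (hab : a ≤ b) (hf : ∀ s, f s ≤ 0) :
    ∫ s in a..b, f s ≤ 0 := by
  have h := intervalIntegral.integral_nonneg_of_forall (μ := volume) hab
    fun s => neg_nonneg.2 (hf s)
  rwa [intervalIntegral.integral_neg, neg_nonneg] at h

/-- Needed to exchange the sum over coordinates with the time integral. Stopping the clock at `t`
turns progressive measurability on `[0, t]` into measurability of a path on the whole line. -/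
lemma intervalIntegrable_control {𝓕 : Filtration ℝ≥0 mΩ} {n : ℕ} {Φ : ℝ≥0 → Ω → Fin n → ℝ}
    (hΦ : Φ ∈ admissible 𝓕 n) (b : ℝ) (i : Fin n) (t : ℝ≥0) (ω : Ω) :
    IntervalIntegrable (fun s : ℝ => b + Φ s.toNNReal ω i) volume 0 t := by
  have hmeas : Measurable fun s : ℝ => Φ (min s.toNNReal t) ω i := by
    have h1 : Measurable fun s : ℝ =>
        (⟨min s.toNNReal t, Set.mem_Iic.2 (min_le_right _ _)⟩ : Set.Iic t) :=
      (measurable_real_toNNReal.min measurable_const).subtype_mk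
    have h2 : @Measurable _ _ _ (Subtype.instMeasurableSpace.prod (𝓕 t))
        fun s : ℝ => ((⟨min s.toNNReal t, Set.mem_Iic.2 (min_le_right _ _)⟩ : Set.Iic t), ω) :=
      @Measurable.prodMk _ _ _ _ _ (𝓕 t) _ _ h1 (@measurable_const _ _ (𝓕 t) _ ω)
    exact (measurable_pi_apply i).comp ((hΦ.1 t).comp h2)
  have hint : IntervalIntegrable (fun s : ℝ => b + Φ (min s.toNNReal t) ω i) volume 0 t := by
    refine intervalIntegrable_const.add ?_
    rw [intervalIntegrable_iff]
    refine Measure.integrableOn_of_bounded (M := 1) (by simp) hmeas.aestronglyMeasurable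
      (Eventually.of_forall fun s => ?_)
    obtain ⟨h0, h1⟩ := hΦ.2.1 (min s.toNNReal t) ω i
    rwa [Real.norm_of_nonneg h0]
  refine hint.congr fun s hs => ?_
  rw [Set.uIoc_of_le t.coe_nonneg] at hs
  have : min s.toNNReal t = s.toNNReal := min_eq_left (Real.toNNReal_le_iff_le_coe.2 hs.2)
  simp only [this]

/-- If the drift of every coordinate stays nonpositive, no coordinate survives. -/
lemma ae_survives_eq_zero [IsProbabilityMeasure P] {𝓕 : Filtration ℝ≥0 mΩ}
    {W : ℕ → ℝ≥0 → Ω → ℝ} (hW : ∀ k, IsFBrownianMotion P 𝓕 (W k)) {b : ℝ} (hb : b ≤ -1)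
    {n : ℕ} (x : Fin n → ℝ) {Φ : ℝ≥0 → Ω → Fin n → ℝ} (hΦ : Φ ∈ admissible 𝓕 n) (i : Fin n) :
    ∀ᵐ ω ∂P, survives W b x Φ i ω = 0 := by
  filter_upwards [ae_forall_exists_le_neg (hW i).brownian.toIsPreBrownianReal
    fun t => ((hW i).adapted t).mono (𝓕.le t) le_rfl] with ω hω
  by_contra h
  rw [← ne_eq, survives_ne_zero_iff] at h
  obtain ⟨t, ht⟩ := hω (x i)
  have hpos := h t
  have hint : ∫ s in (0 : ℝ)..(t : ℝ), (b + Φ s.toNNReal ω i) ≤ 0 :=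
    integral_nonpos_of_forall t.2 fun s => by
      linarith [(hΦ.2.1 s.toNNReal ω i).2]
  rw [state] at hpos
  linarith

/-- If the total drift stays nonpositive, the coordinates do not all survive. -/
lemma ae_prod_survives_eq_zero [IsProbabilityMeasure P] {𝓕 : Filtration ℝ≥0 mΩ}
    {W : ℕ → ℝ≥0 → Ω → ℝ} (hW : ∀ k, IsFBrownianMotion P 𝓕 (W k))
    (hind : iIndepFun (fun (k : ℕ) (ω : Ω) (t : ℝ≥0) => W k t ω) P) {b : ℝ} {n : ℕ} (hn : n ≠ 0)
    (hb : n * b + 1 ≤ 0) (x : Fin n → ℝ) {Φ : ℝ≥0 → Ω → Fin n → ℝ} (hΦ : Φ ∈ admissible 𝓕 n) :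
    ∀ᵐ ω ∂P, ∏ i, survives W b x Φ i ω = 0 := by
  have hmeas : ∀ (k : ℕ) t, Measurable (W k t) := fun k t =>
    ((hW k).adapted t).mono (𝓕.le t) le_rfl
  have hsum := isPreBrownianReal_sum hn (W := fun i : Fin n => W i)
    (fun i => (hW i).brownian.toIsPreBrownianReal) (hind.precomp Fin.val_injective)
  have hsqrt : 0 < √(n : ℝ) := Real.sqrt_pos.2 (by positivity)
  filter_upwards [ae_forall_exists_le_neg hsum fun t =>
    (Finset.measurable_fun_sum Finset.univ fun (i : Fin n) _ => hmeas i t).const_mul _] with ω hω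
  by_contra h
  rw [← ne_eq, Finset.prod_ne_zero_iff] at h
  -- After removing the factor `1/√n`, this level says that the noises sum to at most `-∑ i, x i`.
  obtain ⟨t, ht⟩ := hω ((√(n : ℝ))⁻¹ * ∑ i, x i)
  rw [← mul_neg, mul_le_mul_iff_right₀ (inv_pos.2 hsqrt)] at ht
  have hpos : 0 < ∑ i, state W b x Φ i t ω := by
    have : Nonempty (Fin n) := ⟨⟨0, Nat.pos_of_ne_zero hn⟩⟩
    exact Finset.sum_pos (fun i hi => survives_ne_zero_iff.1 (h i hi) t) Finset.univ_nonempty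
  have hint : ∑ i, ∫ s in (0 : ℝ)..(t : ℝ), (b + Φ s.toNNReal ω i) ≤ 0 := by
    rw [← intervalIntegral.integral_finsetSum fun i _ => intervalIntegrable_control hΦ b i t ω]
    refine integral_nonpos_of_forall t.2 fun s => ?_
    rw [Finset.sum_add_distrib]
    simp only [Finset.sum_const, Finset.card_univ, Fintype.card_fin, nsmul_eq_mul]
    linarith [hΦ.2.2 s.toNNReal ω]
  simp only [state, Finset.sum_add_distrib] at hpos
  linarith

lemma state_const (W : ℕ → ℝ≥0 → Ω → ℝ) (b : ℝ) {n : ℕ} (x a : Fin n → ℝ) (i : Fin n)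
    (t : ℝ≥0) (ω : Ω) :
    state W b x (fun _ _ => a) i t ω = x i + (b + a i) * t + W i t ω := by
  simp only [state, intervalIntegral.integral_const, sub_zero, smul_eq_mul]
  ring

lemma const_mem_admissible (𝓕 : Filtration ℝ≥0 mΩ) {n : ℕ} {a : Fin n → ℝ} (h0 : ∀ i, 0 ≤ a i)
    (h1 : ∑ i, a i ≤ 1) : (fun _ _ => a) ∈ admissible 𝓕 n :=
  ⟨isProgressive_const 𝓕 a, fun _ _ i => ⟨h0 i,
    (Finset.single_le_sum (fun j _ => h0 j) (Finset.mem_univ i)).trans h1⟩, fun _ _ => h1⟩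

/-- By compactness, positivity on `[0, N]` is a uniform positive lower bound, which can be tested on
a dense sequence. This gives survival a countable description. -/
lemma forall_pos_iff_denseSeq {f : ℝ≥0 → ℝ} (hf : Continuous f) :
    (∀ t, 0 < f t) ↔ ∀ N : ℕ, ∃ k : ℕ, ∀ j : ℕ, TopologicalSpace.denseSeq ℝ≥0 j < N →
      1 / ((k : ℝ) + 1) ≤ f (TopologicalSpace.denseSeq ℝ≥0 j) := by
  constructor
  · intro h N
    obtain ⟨t, -, ht⟩ := (isCompact_Icc (a := (0 : ℝ≥0)) (b := N)).exists_isMinOn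
      ⟨0, by simp⟩ hf.continuousOn
    obtain ⟨k, hk⟩ := exists_nat_one_div_lt (h t)
    exact ⟨k, fun j hj => hk.le.trans (ht ⟨zero_le, hj.le⟩)⟩
  · intro h t
    obtain ⟨N, hN⟩ := exists_nat_gt t
    obtain ⟨k, hk⟩ := h N
    have hcl : IsClosed {s | 1 / ((k : ℝ) + 1) ≤ f s} := isClosed_le continuous_const hf
    have hsub : Set.Iio (N : ℝ≥0) ⊆ {s | 1 / ((k : ℝ) + 1) ≤ f s} := by
      refine ((TopologicalSpace.denseRange_denseSeq ℝ≥0).open_subset_closure_inter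
        isOpen_Iio).trans (closure_minimal ?_ hcl)
      rintro _ ⟨hs, j, rfl⟩
      exact hk j hs
    exact lt_of_lt_of_le (by positivity) (hsub (Set.mem_Iio.2 hN))

/-- The countable description agrees with survival only on continuous paths, hence almost
everywhere. Measurability matters for the lower bounds because the integral of a non-measurable
function is `0` by convention. -/
lemma aemeasurable_survives_const {𝓕 : Filtration ℝ≥0 mΩ} {W : ℕ → ℝ≥0 → Ω → ℝ}
    (hW : ∀ k, IsFBrownianMotion P 𝓕 (W k)) (b : ℝ) {n : ℕ} (x a : Fin n → ℝ) (i : Fin n) :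
    AEMeasurable (survives W b x (fun _ _ => a) i) P := by
  have hstate : ∀ t, Measurable (state W b x (fun _ _ => a) i t) := fun t => by
    have : Measurable (W i t) := ((hW i).adapted t).mono (𝓕.le t) le_rfl
    simp only [funext (state_const W b x a i t)]
    fun_prop
  set A : Set Ω := {ω | ∀ N : ℕ, ∃ k : ℕ, ∀ j : ℕ, TopologicalSpace.denseSeq ℝ≥0 j < N →
      1 / ((k : ℝ) + 1) ≤ state W b x (fun _ _ => a) i (TopologicalSpace.denseSeq ℝ≥0 j) ω}
    with hA
  have hAm : MeasurableSet A := by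
    have : A = ⋂ N : ℕ, ⋃ k : ℕ, ⋂ j : ℕ, ⋂ _ : TopologicalSpace.denseSeq ℝ≥0 j < N,
        {ω | 1 / ((k : ℝ) + 1) ≤
          state W b x (fun _ _ => a) i (TopologicalSpace.denseSeq ℝ≥0 j) ω} := by
      ext ω; simp [A]
    rw [this]
    exact MeasurableSet.iInter fun N => MeasurableSet.iUnion fun k => MeasurableSet.iInter fun j =>
      MeasurableSet.iInter fun _ => measurableSet_le measurable_const (hstate _)
  refine ⟨A.indicator fun _ => 1, measurable_const.indicator hAm, ?_⟩
  filter_upwards [(hW i).brownian.cont] with ω hω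
  have hcont : Continuous fun t => state W b x (fun _ _ => a) i t ω := by
    simp only [state_const]
    fun_prop
  by_cases h : ω ∈ A
  · rw [Set.indicator_of_mem h, survives_eq_one_iff]
    exact (forall_pos_iff_denseSeq hcont).2 h
  · rw [Set.indicator_of_notMem h]
    by_contra hne
    exact h ((forall_pos_iff_denseSeq hcont).1 (survives_ne_zero_iff.1 hne))

lemma integrable_survives_const [IsProbabilityMeasure P] {𝓕 : Filtration ℝ≥0 mΩ}
    {W : ℕ → ℝ≥0 → Ω → ℝ} (hW : ∀ k, IsFBrownianMotion P 𝓕 (W k)) (b : ℝ) {n : ℕ}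
    (x a : Fin n → ℝ) (i : Fin n) : Integrable (survives W b x (fun _ _ => a) i) P :=
  .of_bound (aemeasurable_survives_const hW b x a i).aestronglyMeasurable 1
    (.of_forall fun ω => by
      rw [Real.norm_of_nonneg (survives_nonneg ..)]
      exact survives_le_one ..)

lemma integrable_prod_survives_const [IsProbabilityMeasure P] {𝓕 : Filtration ℝ≥0 mΩ}
    {W : ℕ → ℝ≥0 → Ω → ℝ} (hW : ∀ k, IsFBrownianMotion P 𝓕 (W k)) (b : ℝ) {n : ℕ}
    (x a : Fin n → ℝ) : Integrable (fun ω => ∏ i, survives W b x (fun _ _ => a) i ω) P :=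
  .of_bound (Finset.aemeasurable_fun_prod _ fun i _ =>
      aemeasurable_survives_const hW b x a i).aestronglyMeasurable 1
    (.of_forall fun ω => by
      rw [Real.norm_of_nonneg (Finset.prod_nonneg fun i _ => survives_nonneg ..)]
      exact Finset.prod_le_one (fun i _ => survives_nonneg ..) fun i _ => survives_le_one ..)

lemma survives_const_of_mem_pathsAbove {W : ℕ → ℝ≥0 → Ω → ℝ} {b : ℝ} {n : ℕ}
    {x a : Fin n → ℝ} {i : Fin n} (hx : 0 < x i) {ω : Ω} (hc : Continuous (W i · ω))
    (h : (fun t => W i t ω) ∈ pathsAbove (b + a i) (x i / 2)) :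
    survives W b x (fun _ _ => a) i ω ≠ 0 := by
  rw [survives_ne_zero_iff]
  intro t
  have := le_of_mem_pathsAbove hc h t
  rw [state_const]
  linarith

lemma integral_survives_const_pos [IsProbabilityMeasure P] {𝓕 : Filtration ℝ≥0 mΩ}
    {W : ℕ → ℝ≥0 → Ω → ℝ} (hW : ∀ k, IsFBrownianMotion P 𝓕 (W k)) {b : ℝ} {n : ℕ}
    {x a : Fin n → ℝ} {i : Fin n} (hx : 0 < x i) (ha : 0 < b + a i) :
    0 < ∫ ω, survives W b x (fun _ _ => a) i ω ∂P := by
  rw [integral_pos_iff_support_of_nonneg (fun ω => survives_nonneg ..)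
    (integrable_survives_const hW b x a i)]
  refine (measure_pathsAbove_pos (hW i) ha (half_pos hx)).trans_le (measure_mono_ae ?_)
  filter_upwards [(hW i).brownian.cont] with ω hc h
  exact survives_const_of_mem_pathsAbove hx hc h

lemma integral_prod_survives_const_pos [IsProbabilityMeasure P] {𝓕 : Filtration ℝ≥0 mΩ}
    {W : ℕ → ℝ≥0 → Ω → ℝ} (hW : ∀ k, IsFBrownianMotion P 𝓕 (W k))
    (hind : iIndepFun (fun (k : ℕ) (ω : Ω) (t : ℝ≥0) => W k t ω) P) {b : ℝ} {n : ℕ}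
    {x a : Fin n → ℝ} (hx : ∀ i, 0 < x i) (ha : ∀ i, 0 < b + a i) :
    0 < ∫ ω, ∏ i, survives W b x (fun _ _ => a) i ω ∂P := by
  rw [integral_pos_iff_support_of_nonneg
    (fun ω => Finset.prod_nonneg fun i _ => survives_nonneg ..)
    (integrable_prod_survives_const hW b x a)]
  have hmeas := (hind.precomp (Fin.val_injective (n := n))).measure_inter_preimage_eq_mul
    Finset.univ (sets := fun i => pathsAbove (b + a i) (x i / 2))
    fun i _ => measurableSet_pathsAbove _ _
  have hpos : 0 < ∏ i, P {ω | (fun t => W (i : Fin n) t ω) ∈ pathsAbove (b + a i) (x i / 2)} :=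
    pos_iff_ne_zero.2 (Finset.prod_ne_zero_iff.2 fun i _ =>
      (measure_pathsAbove_pos (hW i) (ha i) (half_pos (hx i))).ne')
  refine (hpos.trans_eq hmeas.symm).trans_le (measure_mono_ae ?_)
  filter_upwards [ae_all_iff.2 fun k => (hW k).brownian.cont] with ω hc h
  have h : ω ∈ ⋂ i ∈ Finset.univ, (fun ω t => W (i : Fin n) t ω) ⁻¹'
    pathsAbove (b + a i) (x i / 2) := h
  simp only [Set.mem_iInter] at h
  exact Finset.prod_ne_zero_iff.2 fun i hi =>
    survives_const_of_mem_pathsAbove (hx i) (hc i) (h i hi)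

theorem V_pos_iff [IsProbabilityMeasure P] {𝓕 : Filtration ℝ≥0 mΩ}
    {W : ℕ → ℝ≥0 → Ω → ℝ} (hW : ∀ k, IsFBrownianMotion P 𝓕 (W k))
    (hind : iIndepFun (fun (k : ℕ) (ω : Ω) (t : ℝ≥0) => W k t ω) P) {b : ℝ} {n : ℕ}
    (hn : 1 ≤ n) {x : Fin n → ℝ} (hx : x ∈ openOrthant n) :
    0 < V P 𝓕 W b n x ↔ -(1 / (n : ℝ)) < b := by
  have hn0 : (0 : ℝ) < n := by exact_mod_cast hn
  constructor
  · intro hV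
    by_contra! hb
    refine hV.not_ge (Real.iSup_nonpos fun Φ => ?_)
    have hb' : n * b + 1 ≤ 0 := by
      have := mul_le_mul_of_nonneg_left hb hn0.le
      have hne : (n : ℝ) * (1 / n) = 1 := by field_simp
      linarith
    -- The integrand vanishes a.e. for every control, so no measurability of survival under general
    -- controls is required.
    rw [integral_eq_zero_of_ae
      (ae_prod_survives_eq_zero hW hind (Nat.one_le_iff_ne_zero.1 hn) hb' x Φ.2)]
  · intro hb
    have hmem : (fun _ _ _ => 1 / (n : ℝ)) ∈ admissible 𝓕 n :=
      const_mem_admissible 𝓕 (fun _ => by positivity) (by simp [hn0.ne'])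
    exact (integral_prod_survives_const_pos hW hind hx fun _ => by linarith).trans_le
      (le_ciSup (bddAbove_V P 𝓕 W b n x) ⟨_, hmem⟩)

theorem U_pos_iff [IsProbabilityMeasure P] {𝓕 : Filtration ℝ≥0 mΩ}
    {W : ℕ → ℝ≥0 → Ω → ℝ} (hW : ∀ k, IsFBrownianMotion P 𝓕 (W k)) {b : ℝ} {n : ℕ}
    (hn : 1 ≤ n) {x : Fin n → ℝ} (hx : x ∈ openOrthant n) :
    0 < U P 𝓕 W b n x ↔ -1 < b := by
  constructor
  · intro hU
    by_contra! hb
    refine hU.not_ge (Real.iSup_nonpos fun Φ => ?_)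
    rw [integral_eq_zero_of_ae]
    filter_upwards [ae_all_iff.2 fun i => ae_survives_eq_zero hW hb x Φ.2 i] with ω hω
    exact Finset.sum_eq_zero fun i _ => hω i
  · intro hb
    set i₀ : Fin n := ⟨0, hn⟩
    have hmem : (fun _ _ => Pi.single i₀ (1 : ℝ)) ∈ admissible 𝓕 n :=
      const_mem_admissible 𝓕 (fun i => by by_cases h : i = i₀ <;> simp [h]) (by simp)
    have hpos : 0 < ∫ ω, ∑ i, survives W b x (fun _ _ => Pi.single i₀ (1 : ℝ)) i ω ∂P := by
      rw [integral_finsetSum _ fun i _ => integrable_survives_const hW b x _ i]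
      refine Finset.sum_pos' (fun i _ => integral_nonneg fun ω => survives_nonneg ..)
        ⟨i₀, Finset.mem_univ _, integral_survives_const_pos hW (hx i₀) ?_⟩
      simp only [Pi.single_eq_same]
      linarith
    exact hpos.trans_le (le_ciSup (bddAbove_U P 𝓕 W b n x) ⟨_, hmem⟩)

end Controls

end Allocation

theorem lemma1p3 {Ω : Type*} {mΩ : MeasurableSpace Ω} (P : Measure Ω) [IsProbabilityMeasure P]
    (𝓕 : Filtration ℝ≥0 mΩ) (h𝓕 : Allocation.UsualConditions P 𝓕)
    (W : ℕ → ℝ≥0 → Ω → ℝ) (hW : ∀ k, Allocation.IsFBrownianMotion P 𝓕 (W k))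
    (hind : iIndepFun (fun (k : ℕ) (ω : Ω) (t : ℝ≥0) => W k t ω) P)
    (b : ℝ) (n : ℕ) (hn : 1 ≤ n) (x : Fin n → ℝ) (hx : x ∈ Allocation.openOrthant n) :
    (0 < Allocation.V P 𝓕 W b n x ↔ -(1 / (n : ℝ)) < b) ∧
      (0 < Allocation.U P 𝓕 W b n x ↔ -1 < b) := by
  exact ⟨Allocation.V_pos_iff hW hind hn hx, Allocation.U_pos_iff hW hn hx⟩
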